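/- Let $x : D \to \mathbb{R}^3$, $x = x(u,v)$, be a smooth regular parametrized surface $S$ on an open set $D \subseteq \mathbb{R}^2$, without umbilical points and parametrized by principal parameters: with $l = (x_u \times x_v)/|x_u \times x_v|$, the coefficients $E,F,G$ and $L,M,N$ of the first and second fundamental forms satisfy $F = M = 0$ on $D$. Let $\nu_1 = L/E$ and $\nu_2 = N/G$ be the principal curvatures (so $\nu_1 \neq \nu_2$ everywhere), and let $$\gamma_1 = -\frac{E_v}{2E\sqrt{G}}, \qquad \gamma_2 = \frac{G_u}{2G\sqrt{E}}$$ be the geodesic curvatures of the principal lines of the families $\mathcal{F}_1$ ($v = \mathrm{const}$) and $\mathcal{F}_2$ ($u = \mathrm{const}$), respectively. Suppose that 1. $S$ is a Weingarten surface: there is a differentiable function $w$ on an interval $\mathcal{I} \subseteq \mathbb{R}$ such that $\nu_1 \in \mathcal{I}$ and $\nu_2 = w(\nu_1)$ at every point of $D$; 2. $\gamma_1 = 0$ on $D$, i.e. the family $\mathcal{F}_1$ consists of geodesics; 3. the principal lines of $\mathcal{F}_2$ have nowhere vanishing curvature as space curves, i.e. $\gamma_2^2 + \nu_2^2 > 0$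 on $D$. Then $S$ is locally part of a surface of revolution: every point of $D$ has an open neighbourhood $U \subseteq D$ on which, after a smooth change of parameters $(u,v) \mapsto (t,\varphi)$ (a diffeomorphism of $U$ onto an open subset of $J \times \mathbb{R}$, where $J$ is an open interval), the surface is given by $$c + r(t)\,(\cos\varphi\; e_1 + \sin\varphi\; e_2) + z(t)\, e_3,$$ with a point $c \in \mathbb{R}^3$, an orthonormal basis $e_1,e_2,e_3$ of $\mathbb{R}^3$, and smooth functions $r > 0$ and $z$ on $J$ such that $(r',z') \neq (0,0)$ everywhere. -/

import Mathlib

open scoped ContDiff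

noncomputable section

namespace WeingartenSurface

/-- Euclidean three-space. -/
abbrev E3 : Type := EuclideanSpace ℝ (Fin 3)

/-- Partial derivative with respect to the first parameter `u`. -/
def du {V : Type*} [NormedAddCommGroup V] [NormedSpace ℝ V] (f : ℝ × ℝ → V) (p : ℝ × ℝ) : V :=
  fderiv ℝ f p (1, 0)

/-- Partial derivative with respect to the second parameter `v`. -/
def dv {V : Type*} [NormedAddCommGroup V] [NormedSpace ℝ V] (f : ℝ × ℝ → V) (p : ℝ × ℝ) : V :=
  fderiv ℝ f p (0, 1)

/-- The vector product of Euclidean three-space. -/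
def cross (a b : E3) : E3 := WithLp.toLp 2 (crossProduct a.ofLp b.ofLp)

/-- Unit normal `l` of a parametrized surface, such that `x_u, x_v, l` is right oriented. -/
def normal (x : ℝ × ℝ → E3) (p : ℝ × ℝ) : E3 :=
  ‖cross (du x p) (dv x p)‖⁻¹ • cross (du x p) (dv x p)

/-- First fundamental form: `E = ⟨x_u, x_u⟩`. -/
def coeffE (x : ℝ × ℝ → E3) (p : ℝ × ℝ) : ℝ := inner ℝ (du x p) (du x p)

/-- First fundamental form: `F = ⟨x_u, x_v⟩`. -/
def coeffF (x : ℝ × ℝ → E3) (p : ℝ × ℝ) : ℝ := inner ℝ (du x p) (dv x p)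

/-- First fundamental form: `G = ⟨x_v, x_v⟩`. -/
def coeffG (x : ℝ × ℝ → E3) (p : ℝ × ℝ) : ℝ := inner ℝ (dv x p) (dv x p)

/-- Second fundamental form: `L = ⟨x_uu, l⟩`. -/
def coeffL (x : ℝ × ℝ → E3) (p : ℝ × ℝ) : ℝ := inner ℝ (du (du x) p) (normal x p)

/-- Second fundamental form: `M = ⟨x_uv, l⟩`. -/
def coeffM (x : ℝ × ℝ → E3) (p : ℝ × ℝ) : ℝ := inner ℝ (dv (du x) p) (normal x p)

/-- Second fundamental form: `N = ⟨x_vv, l⟩`. -/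
def coeffN (x : ℝ × ℝ → E3) (p : ℝ × ℝ) : ℝ := inner ℝ (dv (dv x) p) (normal x p)

/-- Principal curvature `ν₁` in principal parameters (normal curvature of the `u`-lines). -/
def nu1 (x : ℝ × ℝ → E3) (p : ℝ × ℝ) : ℝ := coeffL x p / coeffE x p

/-- Principal curvature `ν₂` in principal parameters (normal curvature of the `v`-lines). -/
def nu2 (x : ℝ × ℝ → E3) (p : ℝ × ℝ) : ℝ := coeffN x p / coeffG x p

/-- Geodesic curvature `γ₁ = -E_v / (2 E √G)` of the lines of the first family
(`v` constant), in orthogonal parameters. -/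
def gamma1 (x : ℝ × ℝ → E3) (p : ℝ × ℝ) : ℝ :=
  -dv (coeffE x) p / (2 * coeffE x p * √(coeffG x p))

/-- Geodesic curvature `γ₂ = G_u / (2 G √E)` of the lines of the second family
(`u` constant), in orthogonal parameters. -/
def gamma2 (x : ℝ × ℝ → E3) (p : ℝ × ℝ) : ℝ :=
  du (coeffG x) p / (2 * coeffG x p * √(coeffE x p))

/-- A smooth regular surface `x = x(u,v)`, `(u,v) ∈ D`, without umbilical points, whose
parametric lines are its principal lines. -/
structure IsPrincipalSurface (x : ℝ × ℝ → E3) (D : Set (ℝ × ℝ)) : Prop where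
  isOpen : IsOpen D
  smooth : ContDiffOn ℝ ∞ x D
  regular : ∀ p ∈ D, LinearIndependent ℝ ![du x p, dv x p]
  coeffF_eq_zero : ∀ p ∈ D, coeffF x p = 0
  coeffM_eq_zero : ∀ p ∈ D, coeffM x p = 0
  no_umbilic : ∀ p ∈ D, nu1 x p ≠ nu2 x p

/-- The Weingarten relation `ν₂ = w(ν₁)` with a differentiable function `w` on an interval. -/
def IsWeingarten (x : ℝ × ℝ → E3) (D : Set (ℝ × ℝ)) : Prop :=
  ∃ (I : Set ℝ) (w : ℝ → ℝ), I.OrdConnected ∧ DifferentiableOn ℝ w I ∧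
    ∀ p ∈ D, nu1 x p ∈ I ∧ nu2 x p = w (nu1 x p)

/-- `Φ(t, φ)`, `t ∈ J`, `φ ∈ ℝ`, parametrizes a rotational surface: the smooth regular profile
curve `(r, z)` on the open interval `J`, which lies in a half-plane and does not meet its
boundary line, is rotated about that line. The line passes through `c` in the direction `e 2`,
and `φ` is the angle of rotation. -/
def IsRotationalSurface (Φ : ℝ × ℝ → E3) (J : Set ℝ) : Prop :=
  ∃ (c : E3) (e : Fin 3 → E3) (r z : ℝ → ℝ),
    Orthonormal ℝ e ∧ IsOpen J ∧ J.OrdConnected ∧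
    ContDiffOn ℝ ∞ r J ∧ ContDiffOn ℝ ∞ z J ∧
    (∀ t ∈ J, 0 < r t) ∧ (∀ t ∈ J, deriv r t ≠ 0 ∨ deriv z t ≠ 0) ∧
    ∀ t ∈ J, ∀ φ : ℝ, Φ (t, φ) =
      c + (r t • (Real.cos φ • e 0 + Real.sin φ • e 1) + z t • e 2)

/-- A smooth change of parameters on an open set `U`: a diffeomorphism of `U` onto its
image, which is open. -/
structure IsParameterChange (h : ℝ × ℝ → ℝ × ℝ) (U : Set (ℝ × ℝ)) : Prop where
  smooth : ContDiffOn ℝ ∞ h U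
  injOn : Set.InjOn h U
  bijective_fderiv : ∀ p ∈ U, Function.Bijective (fderiv ℝ h p)

/-- Every point of the parameter domain has an open neighbourhood on which the surface
is, up to a smooth change of parameters, a piece of a rotational surface. -/
def IsLocallyRotational (x : ℝ × ℝ → E3) (D : Set (ℝ × ℝ)) : Prop :=
  ∀ p ∈ D, ∃ U : Set (ℝ × ℝ), IsOpen U ∧ p ∈ U ∧ U ⊆ D ∧
    ∃ (Φ : ℝ × ℝ → E3) (J : Set ℝ) (h : ℝ × ℝ → ℝ × ℝ),
      IsRotationalSurface Φ J ∧ IsParameterChange h U ∧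
      (∀ q ∈ U, (h q).1 ∈ J) ∧ ∀ q ∈ U, x q = Φ (h q)

end WeingartenSurface

end

/-! Write `X = x_u`, `Y = x_v`, `g = ⟨x_uv, Y⟩/G`. Since `γ₁ = 0` gives `E_v = 0` and `M = 0`, the
vector `x_uv` equals `g Y`. The Codazzi equations become `(ν₁)_v = 0` and `(ν₂)_u = (ν₁ - ν₂) g`.
The Weingarten relation makes `ν₂` independent of `v` too; differentiating the second equation in
`v` and using `ν₁ ≠ ν₂` gives `g_v = 0` (`dv_logDeriv`).

Thus the curvature vector `-(g/E) X + ν₂ l` of a `v`-line has coefficients constant along the line,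
and its `v`-derivative is `-κ² Y` with `κ² = g²/E + ν₂² = γ₂² + ν₂² > 0`: the `v`-lines are circular
arcs. Their planes are parallel: `ν₂ X + g l` is normal to `Y` and constant along a `v`-line, while
the direction of `Y` is constant along `u`-lines (`exists_axis`). Their centres move only along the
common normal `e`, and the principal normal depends on `v` alone (`exists_circles`). Hence `x = c +
r(u) n(v) + z(u) e` with `n` a unit vector in the plane orthogonal to `e`, and the polar angle of
`n` is the angle of rotation (`exists_angle`). -/

noncomputable section

namespace WeingartenSurface

/-! ### Partial derivatives of functions of two variables. -/

section Calculus

variable {V : Type*} [NormedAddCommGroup V] [NormedSpace ℝ V] {U : Set (ℝ × ℝ)} {p : ℝ × ℝ}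

theorem differentiableAt_of_contDiffOn {f : ℝ × ℝ → V} (hU : IsOpen U)
    (hf : ContDiffOn ℝ ∞ f U) (hp : p ∈ U) : DifferentiableAt ℝ f p :=
  (hf.contDiffAt (hU.mem_nhds hp)).differentiableAt (by simp)

theorem contDiffOn_fderiv_apply {f : ℝ × ℝ → V} (hU : IsOpen U)
    (hf : ContDiffOn ℝ ∞ f U) (w : ℝ × ℝ) : ContDiffOn ℝ ∞ (fun p => fderiv ℝ f p w) U :=
  (hf.fderiv_of_isOpen hU (m := ∞) (by simp)).clm_apply contDiffOn_const

theorem contDiffOn_du {f : ℝ × ℝ → V} (hU : IsOpen U) (hf : ContDiffOn ℝ ∞ f U) :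
    ContDiffOn ℝ ∞ (du f) U := contDiffOn_fderiv_apply hU hf _

theorem contDiffOn_dv {f : ℝ × ℝ → V} (hU : IsOpen U) (hf : ContDiffOn ℝ ∞ f U) :
    ContDiffOn ℝ ∞ (dv f) U := contDiffOn_fderiv_apply hU hf _

theorem du_congr {f h : ℝ × ℝ → V} (hU : IsOpen U) (hfh : ∀ q ∈ U, f q = h q) (hp : p ∈ U) :
    du f p = du h p := by
  have : f =ᶠ[nhds p] h := Filter.eventually_of_mem (hU.mem_nhds hp) hfh
  simp only [du, this.fderiv_eq]

theorem dv_congr {f h : ℝ × ℝ → V} (hU : IsOpen U) (hfh : ∀ q ∈ U, f q = h q) (hp : p ∈ U) :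
    dv f p = dv h p := by
  have : f =ᶠ[nhds p] h := Filter.eventually_of_mem (hU.mem_nhds hp) hfh
  simp only [dv, this.fderiv_eq]

@[simp] theorem du_const (c : V) : du (fun _ => c) p = 0 := by simp [du]

@[simp] theorem dv_const (c : V) : dv (fun _ => c) p = 0 := by simp [dv]

theorem du_add {f h : ℝ × ℝ → V} (hf : DifferentiableAt ℝ f p) (hh : DifferentiableAt ℝ h p) :
    du (fun q => f q + h q) p = du f p + du h p := by
  simp only [du]; rw [fderiv_fun_add hf hh]; rfl

theorem dv_add {f h : ℝ × ℝ → V} (hf : DifferentiableAt ℝ f p) (hh : DifferentiableAt ℝ h p) :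
    dv (fun q => f q + h q) p = dv f p + dv h p := by
  simp only [dv]; rw [fderiv_fun_add hf hh]; rfl

theorem du_smul {f : ℝ × ℝ → ℝ} {h : ℝ × ℝ → V} (hf : DifferentiableAt ℝ f p)
    (hh : DifferentiableAt ℝ h p) :
    du (fun q => f q • h q) p = f p • du h p + du f p • h p := by
  simp only [du]; rw [fderiv_fun_smul hf hh]; rfl

theorem dv_smul {f : ℝ × ℝ → ℝ} {h : ℝ × ℝ → V} (hf : DifferentiableAt ℝ f p)
    (hh : DifferentiableAt ℝ h p) :
    dv (fun q => f q • h q) p = f p • dv h p + dv f p • h p := by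
  simp only [dv]; rw [fderiv_fun_smul hf hh]; rfl

theorem du_inner {f h : ℝ × ℝ → E3} (hf : DifferentiableAt ℝ f p)
    (hh : DifferentiableAt ℝ h p) :
    du (fun q => inner ℝ (f q) (h q)) p = inner ℝ (f p) (du h p) + inner ℝ (du f p) (h p) := by
  simp only [du]; rw [fderiv_inner_apply ℝ hf hh]

theorem dv_inner {f h : ℝ × ℝ → E3} (hf : DifferentiableAt ℝ f p)
    (hh : DifferentiableAt ℝ h p) :
    dv (fun q => inner ℝ (f q) (h q)) p = inner ℝ (f p) (dv h p) + inner ℝ (dv f p) (h p) := by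
  simp only [dv]; rw [fderiv_inner_apply ℝ hf hh]

/-- Symmetry of second derivatives. -/
theorem dv_du {f : ℝ × ℝ → V} (hU : IsOpen U) (hf : ContDiffOn ℝ ∞ f U) (hp : p ∈ U) :
    dv (du f) p = du (dv f) p := by
  have hd : DifferentiableAt ℝ (fderiv ℝ f) p :=
    ((hf.fderiv_of_isOpen hU (m := ∞) (by simp)).contDiffAt (hU.mem_nhds hp)).differentiableAt
      (by simp)
  have key : ∀ a b : ℝ × ℝ,
      fderiv ℝ (fun q => fderiv ℝ f q a) p b = fderiv ℝ (fderiv ℝ f) p b a := by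
    intro a b
    rw [fderiv_clm_apply hd (differentiableAt_const a)]
    simp
  have hs : IsSymmSndFDerivAt ℝ f p :=
    (hf.contDiffAt (hU.mem_nhds hp)).isSymmSndFDerivAt
      (by simp; exact WithTop.coe_le_coe.2 (le_top : (2 : ℕ∞) ≤ ⊤))
  change fderiv ℝ (fun q => fderiv ℝ f q (1, 0)) p (0, 1) =
    fderiv ℝ (fun q => fderiv ℝ f q (0, 1)) p (1, 0)
  rw [key, key]
  exact hs _ _

theorem hasDerivAt_dv {f : ℝ × ℝ → V} {a s : ℝ} (hf : DifferentiableAt ℝ f (a, s)) :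
    HasDerivAt (fun s => f (a, s)) (dv f (a, s)) s :=
  hf.hasFDerivAt.comp_hasDerivAt s ((hasDerivAt_const s a).prodMk (hasDerivAt_id s))

theorem hasDerivAt_du {f : ℝ × ℝ → V} {s b : ℝ} (hf : DifferentiableAt ℝ f (s, b)) :
    HasDerivAt (fun s => f (s, b)) (du f (s, b)) s :=
  hf.hasFDerivAt.comp_hasDerivAt s ((hasDerivAt_id s).prodMk (hasDerivAt_const s b))

/-- No regularity of `f` is needed: where the composite is not differentiable, `fderiv` takes its
default value zero. -/
theorem dv_comp_fst (f : ℝ → V) : dv (fun q : ℝ × ℝ => f q.1) p = 0 := by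
  by_cases h : DifferentiableAt ℝ (fun q : ℝ × ℝ => f q.1) p
  · exact (hasDerivAt_dv (a := p.1) (s := p.2) h).unique (hasDerivAt_const p.2 (f p.1))
  · simp [dv, fderiv_zero_of_not_differentiableAt h]

/-- A ball of `ℝ × ℝ` in the sup metric is a product of intervals, so the coordinate segment joining
the two points stays inside it. -/
theorem eq_of_dv_eq_zero {ε : ℝ} {o : ℝ × ℝ} {f : ℝ × ℝ → V}
    (hf : DifferentiableOn ℝ f (Metric.ball o ε))
    (h0 : ∀ q ∈ Metric.ball o ε, dv f q = 0) {a b b' : ℝ}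
    (h1 : (a, b) ∈ Metric.ball o ε) (h2 : (a, b') ∈ Metric.ball o ε) : f (a, b) = f (a, b') := by
  rw [← ball_prod_same] at h1 h2
  have hd : ∀ s ∈ Metric.ball o.2 ε, HasDerivAt (fun s => f (a, s)) 0 s := by
    intro s hs
    have hm : (a, s) ∈ Metric.ball o ε := by rw [← ball_prod_same]; exact ⟨h1.1, hs⟩
    rw [← h0 _ hm]
    exact hasDerivAt_dv (hf.differentiableAt (Metric.isOpen_ball.mem_nhds hm))
  exact Metric.isOpen_ball.is_const_of_deriv_eq_zero (convex_ball o.2 ε).isPreconnected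
    (fun s hs => (hd s hs).differentiableAt.differentiableWithinAt)
    (fun s hs => (hd s hs).deriv) h1.2 h2.2

theorem eq_of_du_eq_zero {ε : ℝ} {o : ℝ × ℝ} {f : ℝ × ℝ → V}
    (hf : DifferentiableOn ℝ f (Metric.ball o ε))
    (h0 : ∀ q ∈ Metric.ball o ε, du f q = 0) {a a' b : ℝ}
    (h1 : (a, b) ∈ Metric.ball o ε) (h2 : (a', b) ∈ Metric.ball o ε) : f (a, b) = f (a', b) := by
  rw [← ball_prod_same] at h1 h2
  have hd : ∀ s ∈ Metric.ball o.1 ε, HasDerivAt (fun s => f (s, b)) 0 s := by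
    intro s hs
    have hm : (s, b) ∈ Metric.ball o ε := by rw [← ball_prod_same]; exact ⟨hs, h1.2⟩
    rw [← h0 _ hm]
    exact hasDerivAt_du (hf.differentiableAt (Metric.isOpen_ball.mem_nhds hm))
  exact Metric.isOpen_ball.is_const_of_deriv_eq_zero (convex_ball o.1 ε).isPreconnected
    (fun s hs => (hd s hs).differentiableAt.differentiableWithinAt)
    (fun s hs => (hd s hs).deriv) h1.1 h2.1

end Calculus

/-! ### Orthogonality and the vector product in three-space. -/

section VectorAlgebra

/-- Otherwise four nonzero pairwise orthogonal vectors would be independent in dimension three. -/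
theorem eq_zero_of_orthogonal {a b c w : E3} (ha : a ≠ 0) (hb : b ≠ 0) (hc : c ≠ 0)
    (hab : inner ℝ a b = 0) (hac : inner ℝ a c = 0) (hbc : inner ℝ b c = 0)
    (h1 : inner ℝ w a = 0) (h2 : inner ℝ w b = 0) (h3 : inner ℝ w c = 0) : w = 0 := by
  by_contra hw
  have hli : LinearIndependent ℝ ![a, b, c, w] := by
    apply linearIndependent_of_ne_zero_of_inner_eq_zero (𝕜 := ℝ)
    · intro i; fin_cases i <;> simpa
    · intro i j hij
      fin_cases i <;> fin_cases j <;> first | exact absurd rfl hij | skip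
      all_goals simp
      all_goals first | assumption | (rw [real_inner_comm]; assumption)
  have := hli.fintype_card_le_finrank
  simp at this

theorem inner_cross_left (a b : E3) : inner ℝ (cross a b) a = 0 := by
  simp [cross, PiLp.inner_apply, Fin.sum_univ_three, crossProduct]; ring

theorem inner_cross_right (a b : E3) : inner ℝ (cross a b) b = 0 := by
  simp [cross, PiLp.inner_apply, Fin.sum_univ_three, crossProduct]; ring

/-- Lagrange's identity. -/
theorem inner_cross_self (a b : E3) : inner ℝ (cross a b) (cross a b) =
    inner ℝ a a * inner ℝ b b - inner ℝ a b ^ 2 := by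
  simp [-inner_self_eq_norm_sq_to_K, cross, PiLp.inner_apply,
    Fin.sum_univ_three, crossProduct]
  ring

theorem contDiffOn_cross {U : Set (ℝ × ℝ)} {f h : ℝ × ℝ → E3} (hf : ContDiffOn ℝ ∞ f U)
    (hh : ContDiffOn ℝ ∞ h U) : ContDiffOn ℝ ∞ (fun q => cross (f q) (h q)) U := by
  rw [contDiffOn_euclidean] at *
  intro i
  fin_cases i <;> simp [cross, crossProduct]
  · exact ((hf 1).mul (hh 2)).sub ((hf 2).mul (hh 1))
  · exact ((hf 2).mul (hh 0)).sub ((hf 0).mul (hh 2))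
  · exact ((hf 0).mul (hh 1)).sub ((hf 1).mul (hh 0))

end VectorAlgebra

/-! ### The moving frame and its invariants. -/

/-- The first partial derivatives `X`, `Y` and the unit normal `l` of a surface in principal
parameters whose `u`-lines are geodesics. -/
structure IsGeodesicPrincipalFrame (X Y l : ℝ × ℝ → E3) (U : Set (ℝ × ℝ)) : Prop where
  isOpen : IsOpen U
  smooth_X : ContDiffOn ℝ ∞ X U
  smooth_Y : ContDiffOn ℝ ∞ Y U
  smooth_l : ContDiffOn ℝ ∞ l U
  X_ne : ∀ p ∈ U, X p ≠ 0
  Y_ne : ∀ p ∈ U, Y p ≠ 0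
  inner_l_l : ∀ p ∈ U, inner ℝ (l p) (l p) = (1 : ℝ)
  inner_X_Y : ∀ p ∈ U, inner ℝ (X p) (Y p) = (0 : ℝ)
  inner_X_l : ∀ p ∈ U, inner ℝ (X p) (l p) = (0 : ℝ)
  inner_Y_l : ∀ p ∈ U, inner ℝ (Y p) (l p) = (0 : ℝ)
  dv_X : ∀ p ∈ U, dv X p = du Y p
  inner_dv_X_l : ∀ p ∈ U, inner ℝ (dv X p) (l p) = (0 : ℝ)
  inner_dv_X_X : ∀ p ∈ U, inner ℝ (dv X p) (X p) = (0 : ℝ)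

/-- Logarithmic derivative of `|Y|` in the direction `u`. -/
def logDeriv (X Y : ℝ × ℝ → E3) (p : ℝ × ℝ) : ℝ :=
  inner ℝ (dv X p) (Y p) / inner ℝ (Y p) (Y p)

/-- Curvature of the `u`-lines. -/
def curv1 (X l : ℝ × ℝ → E3) (p : ℝ × ℝ) : ℝ :=
  inner ℝ (du X p) (l p) / inner ℝ (X p) (X p)

/-- Normal curvature of the `v`-lines. -/
def curv2 (Y l : ℝ × ℝ → E3) (p : ℝ × ℝ) : ℝ :=
  inner ℝ (dv Y p) (l p) / inner ℝ (Y p) (Y p)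

/-- Curvature vector of the `v`-lines. -/
def curvVec (X Y l : ℝ × ℝ → E3) (p : ℝ × ℝ) : E3 :=
  (-(logDeriv X Y p / inner ℝ (X p) (X p))) • X p + curv2 Y l p • l p

/-- Squared curvature of the `v`-lines. -/
def curvSq (X Y l : ℝ × ℝ → E3) (p : ℝ × ℝ) : ℝ :=
  logDeriv X Y p ^ 2 / inner ℝ (X p) (X p) + curv2 Y l p ^ 2

/-- A vector normal to the osculating planes of the `v`-lines. -/
def axisVec (X Y l : ℝ × ℝ → E3) (p : ℝ × ℝ) : E3 :=
  curv2 Y l p • X p + logDeriv X Y p • l p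

/-- Radius of curvature of the `v`-lines. -/
def radius (X Y l : ℝ × ℝ → E3) (p : ℝ × ℝ) : ℝ := (√(curvSq X Y l p))⁻¹

/-- Principal normal of the `v`-lines. -/
def princNormal (X Y l : ℝ × ℝ → E3) (p : ℝ × ℝ) : E3 :=
  radius X Y l p • curvVec X Y l p

/-! ### Structure equations of the frame and their integrability conditions. -/

namespace IsGeodesicPrincipalFrame

variable {X Y l : ℝ × ℝ → E3} {U : Set (ℝ × ℝ)} {p : ℝ × ℝ}

theorem mono (h : IsGeodesicPrincipalFrame X Y l U) {U' : Set (ℝ × ℝ)} (hU' : IsOpen U')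
    (hs : U' ⊆ U) : IsGeodesicPrincipalFrame X Y l U' where
  isOpen := hU'
  smooth_X := h.smooth_X.mono hs
  smooth_Y := h.smooth_Y.mono hs
  smooth_l := h.smooth_l.mono hs
  X_ne p hp := h.X_ne p (hs hp)
  Y_ne p hp := h.Y_ne p (hs hp)
  inner_l_l p hp := h.inner_l_l p (hs hp)
  inner_X_Y p hp := h.inner_X_Y p (hs hp)
  inner_X_l p hp := h.inner_X_l p (hs hp)
  inner_Y_l p hp := h.inner_Y_l p (hs hp)
  dv_X p hp := h.dv_X p (hs hp)
  inner_dv_X_l p hp := h.inner_dv_X_l p (hs hp)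
  inner_dv_X_X p hp := h.inner_dv_X_X p (hs hp)

theorem l_ne (h : IsGeodesicPrincipalFrame X Y l U) (hp : p ∈ U) : l p ≠ 0 := by
  intro h0
  simpa [h0] using h.inner_l_l p hp

theorem inner_X_X_pos (h : IsGeodesicPrincipalFrame X Y l U) (hp : p ∈ U) :
    (0 : ℝ) < inner ℝ (X p) (X p) := real_inner_self_pos.2 (h.X_ne p hp)

theorem inner_Y_Y_pos (h : IsGeodesicPrincipalFrame X Y l U) (hp : p ∈ U) :
    (0 : ℝ) < inner ℝ (Y p) (Y p) := real_inner_self_pos.2 (h.Y_ne p hp)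

theorem diff_X (h : IsGeodesicPrincipalFrame X Y l U) (hp : p ∈ U) : DifferentiableAt ℝ X p :=
  differentiableAt_of_contDiffOn h.isOpen h.smooth_X hp

theorem diff_Y (h : IsGeodesicPrincipalFrame X Y l U) (hp : p ∈ U) : DifferentiableAt ℝ Y p :=
  differentiableAt_of_contDiffOn h.isOpen h.smooth_Y hp

theorem diff_l (h : IsGeodesicPrincipalFrame X Y l U) (hp : p ∈ U) : DifferentiableAt ℝ l p :=
  differentiableAt_of_contDiffOn h.isOpen h.smooth_l hp

/-- Vectors are determined by their components along the frame. -/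
theorem ext (h : IsGeodesicPrincipalFrame X Y l U) (hp : p ∈ U) {a b : E3}
    (h1 : inner ℝ a (X p) = inner ℝ b (X p)) (h2 : inner ℝ a (Y p) = inner ℝ b (Y p))
    (h3 : inner ℝ a (l p) = inner ℝ b (l p)) : a = b := by
  rw [← sub_eq_zero]
  refine eq_zero_of_orthogonal (h.X_ne p hp) (h.Y_ne p hp) (h.l_ne hp) (h.inner_X_Y p hp)
    (h.inner_X_l p hp) (h.inner_Y_l p hp) ?_ ?_ ?_ <;> rw [inner_sub_left, sub_eq_zero] <;>
    assumption

theorem smooth_logDeriv (h : IsGeodesicPrincipalFrame X Y l U) :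
    ContDiffOn ℝ ∞ (logDeriv X Y) U :=
  ((contDiffOn_dv h.isOpen h.smooth_X).inner ℝ h.smooth_Y).div
    (h.smooth_Y.inner ℝ h.smooth_Y) fun _ hp => (h.inner_Y_Y_pos hp).ne'

theorem smooth_curv1 (h : IsGeodesicPrincipalFrame X Y l U) :
    ContDiffOn ℝ ∞ (curv1 X l) U :=
  ((contDiffOn_du h.isOpen h.smooth_X).inner ℝ h.smooth_l).div
    (h.smooth_X.inner ℝ h.smooth_X) fun _ hp => (h.inner_X_X_pos hp).ne'

theorem smooth_curv2 (h : IsGeodesicPrincipalFrame X Y l U) :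
    ContDiffOn ℝ ∞ (curv2 Y l) U :=
  ((contDiffOn_dv h.isOpen h.smooth_Y).inner ℝ h.smooth_l).div
    (h.smooth_Y.inner ℝ h.smooth_Y) fun _ hp => (h.inner_Y_Y_pos hp).ne'

theorem smooth_curvVec (h : IsGeodesicPrincipalFrame X Y l U) :
    ContDiffOn ℝ ∞ (curvVec X Y l) U :=
  ((h.smooth_logDeriv.div (h.smooth_X.inner ℝ h.smooth_X)
    fun _ hp => (h.inner_X_X_pos hp).ne').neg.smul h.smooth_X).add
    (h.smooth_curv2.smul h.smooth_l)

theorem smooth_curvSq (h : IsGeodesicPrincipalFrame X Y l U) :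
    ContDiffOn ℝ ∞ (curvSq X Y l) U :=
  ((h.smooth_logDeriv.pow 2).div (h.smooth_X.inner ℝ h.smooth_X)
    fun _ hp => (h.inner_X_X_pos hp).ne').add (h.smooth_curv2.pow 2)

theorem smooth_radius (h : IsGeodesicPrincipalFrame X Y l U)
    (hk : ∀ p ∈ U, 0 < curvSq X Y l p) : ContDiffOn ℝ ∞ (radius X Y l) U :=
  (h.smooth_curvSq.sqrt fun p hp => (hk p hp).ne').inv
    fun p hp => (Real.sqrt_pos.2 (hk p hp)).ne'

theorem smooth_princNormal (h : IsGeodesicPrincipalFrame X Y l U)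
    (hk : ∀ p ∈ U, 0 < curvSq X Y l p) : ContDiffOn ℝ ∞ (princNormal X Y l) U :=
  (h.smooth_radius hk).smul h.smooth_curvVec

theorem du_inner_eq (h : IsGeodesicPrincipalFrame X Y l U) (hp : p ∈ U) {A B : ℝ × ℝ → E3}
    {c : ℝ} (hA : DifferentiableAt ℝ A p) (hB : DifferentiableAt ℝ B p)
    (hc : ∀ q ∈ U, inner ℝ (A q) (B q) = c) :
    inner ℝ (du A p) (B p) + inner ℝ (du B p) (A p) = (0 : ℝ) := by
  have := du_congr h.isOpen hc hp
  rw [du_inner hA hB, du_const, real_inner_comm] at this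
  linarith

theorem dv_inner_eq (h : IsGeodesicPrincipalFrame X Y l U) (hp : p ∈ U) {A B : ℝ × ℝ → E3}
    {c : ℝ} (hA : DifferentiableAt ℝ A p) (hB : DifferentiableAt ℝ B p)
    (hc : ∀ q ∈ U, inner ℝ (A q) (B q) = c) :
    inner ℝ (dv A p) (B p) + inner ℝ (dv B p) (A p) = (0 : ℝ) := by
  have := dv_congr h.isOpen hc hp
  rw [dv_inner hA hB, dv_const, real_inner_comm] at this
  linarith

/-- The component along `X` is absent because the `u`-lines are geodesics (`E_v = 0`), the component
along `l` because `M = 0`. -/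
theorem dv_X_eq (h : IsGeodesicPrincipalFrame X Y l U) (hp : p ∈ U) :
    dv X p = logDeriv X Y p • Y p := by
  have hG := (h.inner_Y_Y_pos hp).ne'
  apply h.ext hp <;> rw [real_inner_smul_left]
  · rw [h.inner_dv_X_X p hp, real_inner_comm, h.inner_X_Y p hp, mul_zero]
  · rw [logDeriv, div_mul_cancel₀ _ hG]
  · rw [h.inner_dv_X_l p hp, h.inner_Y_l p hp, mul_zero]

theorem du_Y_eq (h : IsGeodesicPrincipalFrame X Y l U) (hp : p ∈ U) :
    du Y p = logDeriv X Y p • Y p := by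
  rw [← h.dv_X p hp, h.dv_X_eq hp]

theorem inner_dv_Y_X (h : IsGeodesicPrincipalFrame X Y l U) (hp : p ∈ U) :
    inner ℝ (dv Y p) (X p) = -(logDeriv X Y p * inner ℝ (Y p) (Y p)) := by
  have := h.dv_inner_eq hp (h.diff_X hp) (h.diff_Y hp) h.inner_X_Y
  rw [h.dv_X_eq hp, real_inner_smul_left] at this
  linarith

/-- Rodrigues' formula, from differentiating the three relations `⟨X, l⟩ = 0`, `⟨Y, l⟩ = 0`, `⟨l, l⟩
= 1`. -/
theorem du_l_eq (h : IsGeodesicPrincipalFrame X Y l U) (hp : p ∈ U) :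
    du l p = (-curv1 X l p) • X p := by
  have hE := (h.inner_X_X_pos hp).ne'
  have h1 := h.du_inner_eq hp (h.diff_X hp) (h.diff_l hp) h.inner_X_l
  have h2 := h.du_inner_eq hp (h.diff_Y hp) (h.diff_l hp) h.inner_Y_l
  have h3 := h.du_inner_eq hp (h.diff_l hp) (h.diff_l hp) h.inner_l_l
  rw [← h.dv_X p hp, h.inner_dv_X_l p hp] at h2
  apply h.ext hp <;> rw [real_inner_smul_left]
  · rw [curv1, neg_mul, div_mul_cancel₀ _ hE]; linarith
  · rw [h.inner_X_Y p hp]; linarith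
  · rw [h.inner_X_l p hp]; linarith

theorem dv_l_eq (h : IsGeodesicPrincipalFrame X Y l U) (hp : p ∈ U) :
    dv l p = (-curv2 Y l p) • Y p := by
  have hG := (h.inner_Y_Y_pos hp).ne'
  have h1 := h.dv_inner_eq hp (h.diff_X hp) (h.diff_l hp) h.inner_X_l
  have h2 := h.dv_inner_eq hp (h.diff_Y hp) (h.diff_l hp) h.inner_Y_l
  have h3 := h.dv_inner_eq hp (h.diff_l hp) (h.diff_l hp) h.inner_l_l
  rw [h.inner_dv_X_l p hp] at h1
  apply h.ext hp <;> rw [real_inner_smul_left]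
  · rw [real_inner_comm (X p) (Y p), h.inner_X_Y p hp]; linarith
  · rw [curv2, neg_mul, div_mul_cancel₀ _ hG]; linarith
  · rw [h.inner_Y_l p hp]; linarith

/-- The Codazzi equations. -/
theorem codazzi (h : IsGeodesicPrincipalFrame X Y l U) (hp : p ∈ U) :
    dv (curv1 X l) p = 0 ∧
      du (curv2 Y l) p = (curv1 X l p - curv2 Y l p) * logDeriv X Y p := by
  have d1 := differentiableAt_of_contDiffOn h.isOpen h.smooth_curv1 hp
  have d2 := differentiableAt_of_contDiffOn h.isOpen h.smooth_curv2 hp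
  have e1 := dv_congr h.isOpen (fun q hq => h.du_l_eq hq) hp
  have e2 := du_congr h.isOpen (fun q hq => h.dv_l_eq hq) hp
  rw [dv_smul d1.fun_neg (h.diff_X hp), h.dv_X_eq hp] at e1
  rw [du_smul d2.fun_neg (h.diff_Y hp), h.du_Y_eq hp] at e2
  have n1 : dv (fun q => -curv1 X l q) p = -dv (curv1 X l) p := by simp [dv, fderiv_fun_neg]
  have n2 : du (fun q => -curv2 Y l q) p = -du (curv2 Y l) p := by simp [du, fderiv_fun_neg]
  -- Both equations are the components of `l_uv = l_vu` along `X` and `Y`.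
  have e3 := dv_du h.isOpen h.smooth_l hp
  rw [e1, e2, n1, n2] at e3
  have hX := congrArg (fun w => inner ℝ w (X p)) e3
  have hY := congrArg (fun w => inner ℝ w (Y p)) e3
  simp only [inner_add_left, real_inner_smul_left, real_inner_comm (X p) (Y p),
    h.inner_X_Y p hp] at hX hY
  have hE := (h.inner_X_X_pos hp).ne'
  have hG := (h.inner_Y_Y_pos hp).ne'
  constructor
  · apply mul_right_cancel₀ hE; linarith
  · apply mul_right_cancel₀ hG; linarith

theorem dv_curv1 (h : IsGeodesicPrincipalFrame X Y l U) (hp : p ∈ U) :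
    dv (curv1 X l) p = 0 := (h.codazzi hp).1

/-- Differentiate the second Codazzi equation in `v`: the left side vanishes by symmetry of second
derivatives, and the factor `ν₁ - ν₂` is constant in `v` and nonzero, so it can be cancelled. -/
theorem dv_logDeriv (h : IsGeodesicPrincipalFrame X Y l U)
    (h2 : ∀ q ∈ U, dv (curv2 Y l) q = 0) (hne : ∀ q ∈ U, curv1 X l q ≠ curv2 Y l q)
    (hp : p ∈ U) : dv (logDeriv X Y) p = 0 := by
  have d1 := differentiableAt_of_contDiffOn h.isOpen h.smooth_curv1 hp
  have d2 := differentiableAt_of_contDiffOn h.isOpen h.smooth_curv2 hp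
  have d3 := differentiableAt_of_contDiffOn h.isOpen h.smooth_logDeriv hp
  have e1 := dv_congr h.isOpen (fun q hq => (h.codazzi hq).2) hp
  have e2 : dv (fun q => (curv1 X l q - curv2 Y l q) • logDeriv X Y q) p = _ :=
    dv_smul (d1.fun_sub d2) d3
  have e3 : dv (fun q => curv1 X l q - curv2 Y l q) p = 0 := by
    have := h.dv_curv1 hp
    have := h2 p hp
    simp only [dv] at *
    rw [fderiv_fun_sub d1 d2]
    simp [*]
  rw [dv_du h.isOpen h.smooth_curv2 hp, du_congr h.isOpen h2 hp, du_const] at e1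
  simp only [smul_eq_mul] at e2
  rw [e2, e3, zero_mul, add_zero] at e1
  exact (mul_eq_zero.1 e1.symm).resolve_left (sub_ne_zero.2 (hne p hp))

theorem dv_inner_X_X (h : IsGeodesicPrincipalFrame X Y l U) (hp : p ∈ U) :
    dv (fun q => (inner ℝ (X q) (X q) : ℝ)) p = 0 := by
  rw [dv_inner (h.diff_X hp) (h.diff_X hp), real_inner_comm, h.inner_dv_X_X p hp, add_zero]

end IsGeodesicPrincipalFrame

/-- Reduces a partial derivative to an ordinary one along a coordinate line, where the one-variable
rules for quotients, powers and roots apply. -/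
theorem dv_eq_of_hasDerivAt {V : Type*} [NormedAddCommGroup V] [NormedSpace ℝ V]
    {f : ℝ × ℝ → V} {p : ℝ × ℝ} {c : V} (hf : DifferentiableAt ℝ f p)
    (h : HasDerivAt (fun s => f (p.1, s)) c p.2) : dv f p = c :=
  (hasDerivAt_dv (a := p.1) (s := p.2) hf).unique h

theorem du_eq_of_hasDerivAt {V : Type*} [NormedAddCommGroup V] [NormedSpace ℝ V]
    {f : ℝ × ℝ → V} {p : ℝ × ℝ} {c : V} (hf : DifferentiableAt ℝ f p)
    (h : HasDerivAt (fun s => f (s, p.2)) c p.1) : du f p = c :=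
  (hasDerivAt_du (s := p.1) (b := p.2) hf).unique h

/-! ### The `v`-lines are coaxial circular arcs. -/

namespace IsGeodesicPrincipalFrame

variable {X Y l : ℝ × ℝ → E3} {U : Set (ℝ × ℝ)} {p : ℝ × ℝ}

theorem inner_axisVec_Y (h : IsGeodesicPrincipalFrame X Y l U) (hp : p ∈ U) :
    inner ℝ (axisVec X Y l p) (Y p) = (0 : ℝ) := by
  simp only [axisVec, inner_add_left, real_inner_smul_left]
  rw [h.inner_X_Y p hp, real_inner_comm, h.inner_Y_l p hp]; ring

theorem inner_axisVec_self (h : IsGeodesicPrincipalFrame X Y l U) (hp : p ∈ U) :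
    inner ℝ (axisVec X Y l p) (axisVec X Y l p) =
      inner ℝ (X p) (X p) * curvSq X Y l p := by
  have hE := (h.inner_X_X_pos hp).ne'
  simp only [axisVec, inner_add_left, inner_add_right, real_inner_smul_left,
    real_inner_smul_right, real_inner_comm (X p) (l p), h.inner_X_l p hp, h.inner_l_l p hp, curvSq]
  generalize (inner ℝ (X p) (X p) : ℝ) = E at *
  field_simp
  ring

theorem inner_curvVec_self (h : IsGeodesicPrincipalFrame X Y l U) (hp : p ∈ U) :
    inner ℝ (curvVec X Y l p) (curvVec X Y l p) = curvSq X Y l p := by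
  have hE := (h.inner_X_X_pos hp).ne'
  simp only [curvVec, inner_add_left, inner_add_right, real_inner_smul_left,
    real_inner_smul_right, real_inner_comm (X p) (l p), h.inner_X_l p hp, h.inner_l_l p hp, curvSq]
  generalize (inner ℝ (X p) (X p) : ℝ) = E at *
  field_simp
  ring

theorem inner_curvVec_Y (h : IsGeodesicPrincipalFrame X Y l U) (hp : p ∈ U) :
    inner ℝ (curvVec X Y l p) (Y p) = (0 : ℝ) := by
  simp only [curvVec, inner_add_left, real_inner_smul_left]
  rw [h.inner_X_Y p hp, real_inner_comm (Y p) (l p), h.inner_Y_l p hp]; ring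

/-- Decomposition of `x_vv` into tangential part and curvature vector. -/
theorem dv_Y_eq (h : IsGeodesicPrincipalFrame X Y l U) (hp : p ∈ U) :
    dv Y p = (inner ℝ (dv Y p) (Y p) / inner ℝ (Y p) (Y p)) • Y p +
      (inner ℝ (Y p) (Y p) : ℝ) • curvVec X Y l p := by
  have hE := (h.inner_X_X_pos hp).ne'
  have hG := (h.inner_Y_Y_pos hp).ne'
  apply h.ext hp <;> simp only [inner_add_left, real_inner_smul_left]
  · rw [h.inner_dv_Y_X hp, real_inner_comm (X p) (Y p), h.inner_X_Y p hp, curvVec, inner_add_left,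
      real_inner_smul_left, real_inner_smul_left, real_inner_comm (X p) (l p), h.inner_X_l p hp]
    field_simp
    ring
  · rw [h.inner_curvVec_Y hp, div_mul_cancel₀ _ hG]; ring
  · rw [h.inner_Y_l p hp, curvVec, inner_add_left, real_inner_smul_left, real_inner_smul_left,
      h.inner_X_l p hp, h.inner_l_l p hp, curv2]
    field_simp
    ring

/-- The contributions `ν₂ g Y` of `X_v` and `-g ν₂ Y` of `l_v` cancel. This makes each `v`-line
planar. -/
theorem dv_axisVec (h : IsGeodesicPrincipalFrame X Y l U) (hp : p ∈ U)
    (h2 : dv (curv2 Y l) p = 0) (hg : dv (logDeriv X Y) p = 0) :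
    dv (axisVec X Y l) p = 0 := by
  have d2 := differentiableAt_of_contDiffOn h.isOpen h.smooth_curv2 hp
  have d3 := differentiableAt_of_contDiffOn h.isOpen h.smooth_logDeriv hp
  have e := dv_add (d2.fun_smul (h.diff_X hp)) (d3.fun_smul (h.diff_l hp))
  rw [dv_smul d2 (h.diff_X hp), dv_smul d3 (h.diff_l hp), h2, hg, h.dv_X_eq hp,
    h.dv_l_eq hp] at e
  exact e.trans (by module)

theorem diff_inner_X_X (h : IsGeodesicPrincipalFrame X Y l U) (hp : p ∈ U) :
    DifferentiableAt ℝ (fun q => (inner ℝ (X q) (X q) : ℝ)) p :=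
  (h.diff_X hp).inner ℝ (h.diff_X hp)

theorem hasDerivAt_inner_X_X (h : IsGeodesicPrincipalFrame X Y l U) (hp : p ∈ U) :
    HasDerivAt (fun s => (inner ℝ (X (p.1, s)) (X (p.1, s)) : ℝ)) 0 p.2 := by
  have := hasDerivAt_dv (a := p.1) (s := p.2) (h.diff_inner_X_X hp)
  rwa [Prod.mk.eta, h.dv_inner_X_X hp] at this

theorem hasDerivAt_logDeriv (h : IsGeodesicPrincipalFrame X Y l U) (hp : p ∈ U)
    (hg : dv (logDeriv X Y) p = 0) : HasDerivAt (fun s => logDeriv X Y (p.1, s)) 0 p.2 := by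
  rw [← hg]
  exact hasDerivAt_dv (a := p.1) (s := p.2)
    (differentiableAt_of_contDiffOn h.isOpen h.smooth_logDeriv hp)

theorem hasDerivAt_curv2 (h : IsGeodesicPrincipalFrame X Y l U) (hp : p ∈ U)
    (h2 : dv (curv2 Y l) p = 0) : HasDerivAt (fun s => curv2 Y l (p.1, s)) 0 p.2 := by
  rw [← h2]
  exact hasDerivAt_dv (a := p.1) (s := p.2)
    (differentiableAt_of_contDiffOn h.isOpen h.smooth_curv2 hp)

theorem dv_curvSq (h : IsGeodesicPrincipalFrame X Y l U) (hp : p ∈ U)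
    (h2 : dv (curv2 Y l) p = 0) (hg : dv (logDeriv X Y) p = 0) :
    dv (curvSq X Y l) p = 0 := by
  apply dv_eq_of_hasDerivAt (differentiableAt_of_contDiffOn h.isOpen h.smooth_curvSq hp)
  convert! (((h.hasDerivAt_logDeriv hp hg).fun_pow 2).fun_div (h.hasDerivAt_inner_X_X hp)
    (h.inner_X_X_pos hp).ne').fun_add ((h.hasDerivAt_curv2 hp h2).fun_pow 2) using 1
  simp

/-- The coefficients are constant in `v`, and `X_v`, `l_v` are multiples of `Y`: a Frenet equation
with constant curvature and no torsion. -/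
theorem dv_curvVec (h : IsGeodesicPrincipalFrame X Y l U) (hp : p ∈ U)
    (h2 : dv (curv2 Y l) p = 0) (hg : dv (logDeriv X Y) p = 0) :
    dv (curvVec X Y l) p = (-curvSq X Y l p) • Y p := by
  have hE := (h.inner_X_X_pos hp).ne'
  have hX := hasDerivAt_dv (a := p.1) (s := p.2) (h.diff_X hp)
  have hl := hasDerivAt_dv (a := p.1) (s := p.2) (h.diff_l hp)
  apply dv_eq_of_hasDerivAt (differentiableAt_of_contDiffOn h.isOpen h.smooth_curvVec hp)
  convert! ((((h.hasDerivAt_logDeriv hp hg).fun_div (h.hasDerivAt_inner_X_X hp) hE).fun_neg).fun_smul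
    hX).fun_add ((h.hasDerivAt_curv2 hp h2).fun_smul hl) using 1
  simp only [Prod.mk.eta, h.dv_X_eq hp, h.dv_l_eq hp, curvSq]
  match_scalars <;> simp
  ring

theorem dv_radius (h : IsGeodesicPrincipalFrame X Y l U) (hk : ∀ q ∈ U, 0 < curvSq X Y l q)
    (hp : p ∈ U) (h2 : dv (curv2 Y l) p = 0) (hg : dv (logDeriv X Y) p = 0) :
    dv (radius X Y l) p = 0 := by
  have hc := hasDerivAt_dv (a := p.1) (s := p.2)
    (differentiableAt_of_contDiffOn h.isOpen h.smooth_curvSq hp)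
  apply dv_eq_of_hasDerivAt (differentiableAt_of_contDiffOn h.isOpen (h.smooth_radius hk) hp)
  convert! (hc.sqrt (hk p hp).ne').fun_inv (Real.sqrt_pos.2 (hk p hp)).ne' using 1
  simp [h.dv_curvSq hp h2 hg]

theorem radius_pos (hk : 0 < curvSq X Y l p) : 0 < radius X Y l p :=
  inv_pos.2 (Real.sqrt_pos.2 hk)

theorem radius_sq_mul (hk : 0 < curvSq X Y l p) : radius X Y l p ^ 2 * curvSq X Y l p = 1 := by
  rw [radius, inv_pow, Real.sq_sqrt hk.le, inv_mul_cancel₀ hk.ne']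

theorem dv_princNormal (h : IsGeodesicPrincipalFrame X Y l U)
    (hk : ∀ q ∈ U, 0 < curvSq X Y l q)
    (hp : p ∈ U) (h2 : dv (curv2 Y l) p = 0) (hg : dv (logDeriv X Y) p = 0) :
    dv (princNormal X Y l) p = (-(radius X Y l p * curvSq X Y l p)) • Y p := by
  have e : dv (princNormal X Y l) p = _ :=
    dv_smul (differentiableAt_of_contDiffOn h.isOpen (h.smooth_radius hk) hp)
    (differentiableAt_of_contDiffOn h.isOpen h.smooth_curvVec hp)
  rw [e, h.dv_radius hk hp h2 hg, h.dv_curvVec hp h2 hg]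
  module

theorem inner_princNormal_self (h : IsGeodesicPrincipalFrame X Y l U) (hp : p ∈ U)
    (hk : 0 < curvSq X Y l p) :
    inner ℝ (princNormal X Y l p) (princNormal X Y l p) = (1 : ℝ) := by
  rw [princNormal, real_inner_smul_left, real_inner_smul_right, h.inner_curvVec_self hp,
    ← radius_sq_mul hk]
  ring

theorem inner_princNormal_Y (h : IsGeodesicPrincipalFrame X Y l U) (hp : p ∈ U) :
    inner ℝ (princNormal X Y l p) (Y p) = (0 : ℝ) := by
  rw [princNormal, real_inner_smul_left, h.inner_curvVec_Y hp, mul_zero]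

/-- The direction of `Y` is constant along the `u`-lines. -/
theorem du_unit_Y (h : IsGeodesicPrincipalFrame X Y l U) (hp : p ∈ U) :
    du (fun q => (√(inner ℝ (Y q) (Y q)))⁻¹ • Y q) p = 0 := by
  have hG := h.inner_Y_Y_pos hp
  have dG : DifferentiableAt ℝ (fun q => (inner ℝ (Y q) (Y q) : ℝ)) p :=
    (h.diff_Y hp).inner ℝ (h.diff_Y hp)
  have hY := hasDerivAt_du (s := p.1) (b := p.2) (h.diff_Y hp)
  have hG' := hasDerivAt_du (s := p.1) (b := p.2) dG
  have hs := (Real.sqrt_pos.2 hG).ne'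
  apply du_eq_of_hasDerivAt (((dG.sqrt hG.ne').fun_inv hs).fun_smul (h.diff_Y hp))
  convert! ((hG'.sqrt hG.ne').fun_inv hs).fun_smul hY using 1
  simp only [Prod.mk.eta]
  rw [du_inner (h.diff_Y hp) (h.diff_Y hp), h.du_Y_eq hp, real_inner_smul_right,
    real_inner_smul_left]
  match_scalars
  field_simp
  rw [Real.sq_sqrt hG.le]
  ring

/-- All the tangents of the `v`-lines are orthogonal to one direction. -/
theorem exists_axis {o : ℝ × ℝ} {ε : ℝ}
    (h : IsGeodesicPrincipalFrame X Y l (Metric.ball o ε)) (hε : 0 < ε)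
    (hk : 0 < curvSq X Y l o) (h2 : ∀ q ∈ Metric.ball o ε, dv (curv2 Y l) q = 0)
    (hg : ∀ q ∈ Metric.ball o ε, dv (logDeriv X Y) q = 0) :
    ∃ e : E3, inner ℝ e e = (1 : ℝ) ∧ ∀ q ∈ Metric.ball o ε, inner ℝ (Y q) e = (0 : ℝ) := by
  have ho : o ∈ Metric.ball o ε := Metric.mem_ball_self hε
  have ha : axisVec X Y l o ≠ 0 := by
    rw [← real_inner_self_pos, h.inner_axisVec_self ho]
    exact mul_pos (h.inner_X_X_pos ho) hk
  have hperp : ∀ q ∈ Metric.ball o ε, inner ℝ (Y q) (axisVec X Y l o) = (0 : ℝ) := by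
    rintro ⟨s, t⟩ hq
    have hq' : (o.1, t) ∈ Metric.ball o ε := by
      rw [← ball_prod_same] at hq ⊢
      exact ⟨Metric.mem_ball_self hε, hq.2⟩
    have hax : DifferentiableOn ℝ (axisVec X Y l) (Metric.ball o ε) :=
      (((h.smooth_curv2.smul h.smooth_X).add (h.smooth_logDeriv.smul h.smooth_l)).differentiableOn
        (by simp))
    have hY : DifferentiableOn ℝ (fun q => (√(inner ℝ (Y q) (Y q)))⁻¹ • Y q)
        (Metric.ball o ε) := by
      intro q hq
      have hG := h.inner_Y_Y_pos hq
      exact ((((h.diff_Y hq).inner ℝ (h.diff_Y hq)).sqrt hG.ne').fun_inv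
        (Real.sqrt_pos.2 hG).ne' |>.fun_smul (h.diff_Y hq)).differentiableWithinAt
    -- Orthogonality holds at `(o.1, t)`, where the axis vector still equals its value at `o`; it
    -- passes to `(s, t)` along the `u`-line, on which `Y` keeps its direction.
    have e1 := eq_of_dv_eq_zero hax (fun q hq => h.dv_axisVec hq (h2 q hq) (hg q hq))
      (a := o.1) (b := o.2) ho hq'
    have e2 := eq_of_du_eq_zero hY (fun q hq => h.du_unit_Y hq) hq hq'
    have e3 := h.inner_axisVec_Y hq'
    rw [← e1, real_inner_comm] at e3
    have e4 := congrArg (fun w => (inner ℝ w (axisVec X Y l o) : ℝ)) e2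
    simp only [real_inner_smul_left] at e4
    rw [e3, mul_zero] at e4
    exact (mul_eq_zero.1 e4).resolve_left
      (inv_ne_zero (Real.sqrt_pos.2 (h.inner_Y_Y_pos hq)).ne')
  refine ⟨‖axisVec X Y l o‖⁻¹ • axisVec X Y l o, ?_, fun q hq => ?_⟩
  · have := norm_smul_inv_norm (𝕜 := ℝ) ha
    rw [real_inner_self_eq_norm_sq]
    simp only [RCLike.ofReal_real_eq_id, id] at this
    rw [this, one_pow]
  · rw [real_inner_smul_right, hperp q hq, mul_zero]

/-- Differentiate `⟨Y, e⟩ = 0` in `v`: modulo `Y`, the vector `Y_v` is a positive multiple of the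
curvature vector. -/
theorem inner_princNormal_axis (h : IsGeodesicPrincipalFrame X Y l U) {e : E3}
    (he : ∀ q ∈ U, inner ℝ (Y q) e = (0 : ℝ)) (hp : p ∈ U) :
    inner ℝ (princNormal X Y l p) e = (0 : ℝ) := by
  have e1 := h.dv_inner_eq hp (h.diff_Y hp) (differentiableAt_const e) he
  rw [dv_const, inner_zero_left, add_zero, h.dv_Y_eq hp, inner_add_left, real_inner_smul_left,
    real_inner_smul_left, he p hp, mul_zero, zero_add] at e1
  rw [princNormal, real_inner_smul_left,
    (mul_eq_zero.1 e1).resolve_left (h.inner_Y_Y_pos hp).ne', mul_zero]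

/-- The principal normal is a unit vector orthogonal to `e` and to `Y`, and neither of these
directions changes along a `u`-line. -/
theorem du_princNormal (h : IsGeodesicPrincipalFrame X Y l U) {e : E3} (he0 : e ≠ 0)
    (he : ∀ q ∈ U, inner ℝ (Y q) e = (0 : ℝ)) (hk : ∀ q ∈ U, 0 < curvSq X Y l q)
    (hp : p ∈ U) : du (princNormal X Y l) p = 0 := by
  have dn := differentiableAt_of_contDiffOn h.isOpen (h.smooth_princNormal hk) hp
  have hn := h.inner_princNormal_self hp (hk p hp)
  have e1 := h.du_inner_eq hp dn dn (fun q hq => h.inner_princNormal_self hq (hk q hq))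
  have e2 := h.du_inner_eq hp dn (h.diff_Y hp) (fun q hq => h.inner_princNormal_Y hq)
  have e3 := h.du_inner_eq hp dn (differentiableAt_const e)
    (fun q hq => h.inner_princNormal_axis he hq)
  rw [du_const, inner_zero_left, add_zero] at e3
  rw [h.du_Y_eq hp, real_inner_smul_left, real_inner_comm _ (Y p),
    h.inner_princNormal_Y hp, mul_zero, add_zero] at e2
  refine eq_zero_of_orthogonal (a := princNormal X Y l p) (b := Y p) (c := e) ?_ (h.Y_ne p hp) he0
    (h.inner_princNormal_Y hp) (h.inner_princNormal_axis he hp) (he p hp) (by linarith) e2 e3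
  intro h0
  simp [h0] at hn

/-- A surface carrying a frame whose invariants do not depend on `v` is generated by circles
with a common axis. -/
theorem exists_circles {x : ℝ × ℝ → E3} {o : ℝ × ℝ} {ε : ℝ}
    (h : IsGeodesicPrincipalFrame (du x) (dv x) l (Metric.ball o ε))
    (hx : ContDiffOn ℝ ∞ x (Metric.ball o ε)) (hε : 0 < ε)
    (hk : ∀ q ∈ Metric.ball o ε, 0 < curvSq (du x) (dv x) l q)
    (h2 : ∀ q ∈ Metric.ball o ε, dv (curv2 (dv x) l) q = 0)
    (hg : ∀ q ∈ Metric.ball o ε, dv (logDeriv (du x) (dv x)) q = 0) :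
    ∃ (c e : E3) (r z : ℝ → ℝ) (n : ℝ → E3), inner ℝ e e = (1 : ℝ) ∧
      ContDiffOn ℝ ∞ r (Metric.ball o.1 ε) ∧ ContDiffOn ℝ ∞ z (Metric.ball o.1 ε) ∧
      ContDiffOn ℝ ∞ n (Metric.ball o.2 ε) ∧ (∀ s ∈ Metric.ball o.1 ε, 0 < r s) ∧
      (∀ t ∈ Metric.ball o.2 ε, inner ℝ (n t) (n t) = (1 : ℝ) ∧ inner ℝ (n t) e = (0 : ℝ) ∧
        deriv n t ≠ 0) ∧
      ∀ s ∈ Metric.ball o.1 ε, ∀ t ∈ Metric.ball o.2 ε, x (s, t) = c + (r s • n t + z s • e) := by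
  set U := Metric.ball o ε with hU
  have ho : o ∈ U := Metric.mem_ball_self hε
  have hmem : ∀ {s t}, s ∈ Metric.ball o.1 ε → t ∈ Metric.ball o.2 ε → (s, t) ∈ U := by
    intro s t hs ht; rw [hU, ← ball_prod_same]; exact ⟨hs, ht⟩
  have ho1 : o.1 ∈ Metric.ball o.1 ε := Metric.mem_ball_self hε
  have ho2 : o.2 ∈ Metric.ball o.2 ε := Metric.mem_ball_self hε
  obtain ⟨e, he1, he⟩ := h.exists_axis hε (hk o ho) h2 hg
  have he0 : e ≠ 0 := by rintro rfl; simp at he1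
  set N := princNormal (du x) (dv x) l
  set R := radius (du x) (dv x) l
  have sN : ContDiffOn ℝ ∞ N U := h.smooth_princNormal hk
  have sR : ContDiffOn ℝ ∞ R U := h.smooth_radius hk
  -- The centre of the osculating circle of the `v`-line.
  set C : ℝ × ℝ → E3 := fun q => x q + R q • N q with hC
  have sC : ContDiffOn ℝ ∞ C U := hx.add (sR.smul sN)
  have dif : ∀ {V : Type} [NormedAddCommGroup V] [NormedSpace ℝ V] {f : ℝ × ℝ → V},
      ContDiffOn ℝ ∞ f U → ∀ q ∈ U, DifferentiableAt ℝ f q :=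
    fun hf q hq => differentiableAt_of_contDiffOn h.isOpen hf hq
  have duN : ∀ q ∈ U, du N q = 0 := fun q hq => h.du_princNormal he0 he hk hq
  have dvR : ∀ q ∈ U, dv R q = 0 := fun q hq => h.dv_radius hk hq (h2 q hq) (hg q hq)
  have dvN : ∀ q ∈ U, dv N q = _ := fun q hq => h.dv_princNormal hk hq (h2 q hq) (hg q hq)
  have dvC : ∀ q ∈ U, dv C q = 0 := by
    intro q hq
    rw [hC, dv_add (dif hx q hq) ((dif sR q hq).fun_smul (dif sN q hq)),
      dv_smul (dif sR q hq) (dif sN q hq), dvR q hq, dvN q hq]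
    have := radius_sq_mul (hk q hq)
    match_scalars <;> linarith
  have duC : ∀ q ∈ U, du C q = du x q + du R q • N q := by
    intro q hq
    rw [hC, du_add (dif hx q hq) ((dif sR q hq).fun_smul (dif sN q hq)),
      du_smul (dif sR q hq) (dif sN q hq), duN q hq, smul_zero, zero_add]
  have duC_Y : ∀ q ∈ U, inner ℝ (du C q) (dv x q) = (0 : ℝ) := by
    intro q hq
    rw [duC q hq, inner_add_left, real_inner_smul_left, h.inner_X_Y q hq,
      h.inner_princNormal_Y hq]; simp
  have sduC := contDiffOn_du h.isOpen sC
  -- Differentiate `⟨C_u, Y⟩ = 0` in `v`, using `C_uv = 0`. Being orthogonal to `Y` and to `N`, the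
  -- vector `C_u` is parallel to `e`.
  have duC_N : ∀ q ∈ U, inner ℝ (du C q) (N q) = (0 : ℝ) := by
    intro q hq
    have e1 := h.dv_inner_eq hq (dif sduC q hq) (h.diff_Y hq) duC_Y
    rw [dv_du h.isOpen sC hq, du_congr h.isOpen dvC hq, du_const, inner_zero_left, zero_add,
      h.dv_Y_eq hq, inner_add_left, real_inner_smul_left, real_inner_smul_left,
      real_inner_comm (du C q) (dv x q), duC_Y q hq, mul_zero, zero_add] at e1
    rw [real_inner_comm]
    change inner ℝ (R q • _) _ = _
    rw [real_inner_smul_left, (mul_eq_zero.1 e1).resolve_left (h.inner_Y_Y_pos hq).ne', mul_zero]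
  set Z : ℝ × ℝ → ℝ := fun q => inner ℝ (C q) e with hZ
  have sZ : ContDiffOn ℝ ∞ Z U := sC.inner ℝ contDiffOn_const
  have dvZ : ∀ q ∈ U, dv Z q = 0 := by
    intro q hq
    rw [hZ, dv_inner (dif sC q hq) (differentiableAt_const e), dvC q hq]; simp
  have duZ : ∀ q ∈ U, du Z q = inner ℝ (du C q) e := by
    intro q hq
    rw [hZ, du_inner (dif sC q hq) (differentiableAt_const e)]; simp
  have hN1 : ∀ q ∈ U, inner ℝ (N q) (N q) = (1 : ℝ) :=
    fun q hq => h.inner_princNormal_self hq (hk q hq)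
  have hNe : ∀ q ∈ U, inner ℝ (N q) e = (0 : ℝ) := fun q hq => h.inner_princNormal_axis he hq
  -- Removing the axial component of the centre leaves a fixed point of the axis.
  set A : ℝ × ℝ → E3 := fun q => C q + Z q • (-e) with hA
  have sA : ContDiffOn ℝ ∞ A U := sC.add (sZ.smul contDiffOn_const)
  have dvA : ∀ q ∈ U, dv A q = 0 := by
    intro q hq
    rw [hA, dv_add (dif sC q hq) ((dif sZ q hq).fun_smul (differentiableAt_const _)),
      dv_smul (dif sZ q hq) (differentiableAt_const _), dvC q hq, dvZ q hq]; simp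
  have duA : ∀ q ∈ U, du A q = 0 := by
    intro q hq
    rw [hA, du_add (dif sC q hq) ((dif sZ q hq).fun_smul (differentiableAt_const _)),
      du_smul (dif sZ q hq) (differentiableAt_const _), du_const, smul_zero, zero_add, duZ q hq]
    refine eq_zero_of_orthogonal (a := N q) (b := dv x q) (c := e) ?_ (h.Y_ne q hq) he0
      (h.inner_princNormal_Y hq) (hNe q hq) (he q hq) ?_ ?_ ?_
    · intro h0
      have := hN1 q hq
      simp [h0] at this
    all_goals rw [inner_add_left, real_inner_smul_left, inner_neg_left]
    · rw [duC_N q hq, real_inner_comm _ e, hNe q hq]; simp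
    · rw [duC_Y q hq, real_inner_comm _ e, he q hq]; simp
    · rw [he1]; ring
  have memline : ∀ {s t}, s ∈ Metric.ball o.1 ε → t ∈ Metric.ball o.2 ε →
      A (s, t) = A o ∧ R (s, t) = R (s, o.2) ∧ Z (s, t) = Z (s, o.2) ∧ N (s, t) = N (o.1, t) := by
    intro s t hs ht
    refine ⟨?_, ?_, ?_, ?_⟩
    · rw [eq_of_dv_eq_zero (sA.differentiableOn (by simp)) dvA (hmem hs ht) (hmem hs ho2)]
      exact eq_of_du_eq_zero (sA.differentiableOn (by simp)) duA (hmem hs ho2) (hmem ho1 ho2)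
    · exact eq_of_dv_eq_zero (sR.differentiableOn (by simp)) dvR (hmem hs ht) (hmem hs ho2)
    · exact eq_of_dv_eq_zero (sZ.differentiableOn (by simp)) dvZ (hmem hs ht) (hmem hs ho2)
    · exact eq_of_du_eq_zero (sN.differentiableOn (by simp)) duN (hmem hs ht) (hmem ho1 ht)
  have i1 : ContDiffOn ℝ ∞ (fun s : ℝ => (s, o.2)) (Metric.ball o.1 ε) := by fun_prop
  have i2 : ContDiffOn ℝ ∞ (fun t : ℝ => (o.1, t)) (Metric.ball o.2 ε) := by fun_prop
  -- `N` points from the circle to its centre, so the outward radial direction is `-N`.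
  refine ⟨A o, e, fun s => R (s, o.2), fun s => Z (s, o.2), fun t => -N (o.1, t), he1,
    sR.comp i1 fun s hs => hmem hs ho2, sZ.comp i1 fun s hs => hmem hs ho2,
    (sN.comp i2 fun s hs => hmem ho1 hs).neg, fun s hs => radius_pos (hk _ (hmem hs ho2)),
    fun t ht => ⟨?_, ?_, ?_⟩, fun s hs t ht => ?_⟩
  · rw [inner_neg_neg, hN1 _ (hmem ho1 ht)]
  · rw [inner_neg_left, hNe _ (hmem ho1 ht), neg_zero]
  · have hm := hmem ho1 ht
    rw [(hasDerivAt_dv (dif sN _ hm)).fun_neg.deriv, dvN _ hm, neg_smul, neg_neg]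
    exact smul_ne_zero (mul_pos (radius_pos (hk _ hm)) (hk _ hm)).ne' (h.Y_ne _ hm)
  · obtain ⟨a1, a2, a3, a4⟩ := memline hs ht
    simp only [← a1, ← a2, ← a3, ← a4]
    simp only [hA, hC]
    module

end IsGeodesicPrincipalFrame

/-! ### From the surface to its frame. -/

namespace IsPrincipalSurface

variable {x : ℝ × ℝ → E3} {D : Set (ℝ × ℝ)}

theorem du_ne (hS : IsPrincipalSurface x D) {p : ℝ × ℝ} (hp : p ∈ D) : du x p ≠ 0 := by
  simpa using (hS.regular p hp).ne_zero 0

theorem dv_ne (hS : IsPrincipalSurface x D) {p : ℝ × ℝ} (hp : p ∈ D) : dv x p ≠ 0 := by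
  simpa using (hS.regular p hp).ne_zero 1

theorem coeffE_pos (hS : IsPrincipalSurface x D) {p : ℝ × ℝ} (hp : p ∈ D) : 0 < coeffE x p :=
  real_inner_self_pos.2 (hS.du_ne hp)

theorem coeffG_pos (hS : IsPrincipalSurface x D) {p : ℝ × ℝ} (hp : p ∈ D) : 0 < coeffG x p :=
  real_inner_self_pos.2 (hS.dv_ne hp)

theorem cross_ne (hS : IsPrincipalSurface x D) {p : ℝ × ℝ} (hp : p ∈ D) :
    cross (du x p) (dv x p) ≠ 0 := by
  have hF : inner ℝ (du x p) (dv x p) = (0 : ℝ) := hS.coeffF_eq_zero p hp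
  rw [← real_inner_self_pos, inner_cross_self, hF]
  have := mul_pos (hS.coeffE_pos hp) (hS.coeffG_pos hp)
  simpa [coeffE, coeffG] using this

theorem isGeodesicPrincipalFrame (hS : IsPrincipalSurface x D)
    (hγ₁ : ∀ p ∈ D, gamma1 x p = 0) :
    IsGeodesicPrincipalFrame (du x) (dv x) (normal x) D where
  isOpen := hS.isOpen
  smooth_X := contDiffOn_du hS.isOpen hS.smooth
  smooth_Y := contDiffOn_dv hS.isOpen hS.smooth
  smooth_l := by
    have hc := contDiffOn_cross (contDiffOn_du hS.isOpen hS.smooth)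
      (contDiffOn_dv hS.isOpen hS.smooth)
    exact ((hc.norm ℝ fun p hp => hS.cross_ne hp).inv
      fun p hp => norm_ne_zero_iff.2 (hS.cross_ne hp)).smul hc
  X_ne _ := hS.du_ne
  Y_ne _ := hS.dv_ne
  inner_l_l p hp := by
    have := norm_ne_zero_iff.2 (hS.cross_ne hp)
    rw [normal, real_inner_smul_left, real_inner_smul_right, real_inner_self_eq_norm_sq]
    field_simp
  inner_X_Y := hS.coeffF_eq_zero
  inner_X_l p _ := by
    rw [normal, real_inner_smul_right, real_inner_comm, inner_cross_left, mul_zero]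
  inner_Y_l p _ := by
    rw [normal, real_inner_smul_right, real_inner_comm, inner_cross_right, mul_zero]
  dv_X p hp := dv_du hS.isOpen hS.smooth hp
  inner_dv_X_l := hS.coeffM_eq_zero
  inner_dv_X_X p hp := by
    have d := differentiableAt_of_contDiffOn hS.isOpen (contDiffOn_du hS.isOpen hS.smooth) hp
    have h0 := hγ₁ p hp
    have hE := hS.coeffE_pos hp
    have hG := Real.sqrt_pos.2 (hS.coeffG_pos hp)
    rw [gamma1, div_eq_zero_iff, or_iff_left (by positivity), neg_eq_zero] at h0
    have e : dv (coeffE x) p = _ := dv_inner d d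
    rw [h0, real_inner_comm] at e
    linarith

/-- Since `G_u = 2 g G`, the geodesic curvature `γ₂` equals `g / √E`. -/
theorem curvSq_eq (hS : IsPrincipalSurface x D) (hγ₁ : ∀ p ∈ D, gamma1 x p = 0)
    {p : ℝ × ℝ} (hp : p ∈ D) :
    curvSq (du x) (dv x) (normal x) p = gamma2 x p ^ 2 + nu2 x p ^ 2 := by
  have h := hS.isGeodesicPrincipalFrame hγ₁
  have e : du (coeffG x) p = _ := du_inner (h.diff_Y hp) (h.diff_Y hp)
  rw [h.du_Y_eq hp, real_inner_smul_left, real_inner_smul_right] at e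
  have hE := hS.coeffE_pos hp
  have hG := hS.coeffG_pos hp
  change du (coeffG x) p = _ * coeffG x p + _ * coeffG x p at e
  change _ ^ 2 / coeffE x p + nu2 x p ^ 2 = _
  have hs := Real.sqrt_pos.2 hE
  rw [gamma2, e]
  congr 1
  field_simp
  rw [Real.sq_sqrt hE.le]
  ring

end IsPrincipalSurface

/-! ### The rotation angle as a new parameter. -/

/-- A smooth plane curve of unit vectors with nowhere vanishing velocity has a smooth local
polar angle with nowhere vanishing derivative. -/
theorem exists_angle {n : ℝ → E3} {e : E3} {o ε : ℝ} (hε : 0 < ε) (he : inner ℝ e e = (1 : ℝ))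
    (hn : ContDiffOn ℝ ∞ n (Metric.ball o ε))
    (h : ∀ t ∈ Metric.ball o ε, inner ℝ (n t) (n t) = (1 : ℝ) ∧ inner ℝ (n t) e = (0 : ℝ) ∧
        deriv n t ≠ 0) :
    ∃ (δ : ℝ) (a b : E3) (φ : ℝ → ℝ), 0 < δ ∧ δ ≤ ε ∧ Orthonormal ℝ ![a, b, e] ∧
      ContDiffOn ℝ ∞ φ (Metric.ball o δ) ∧ (∀ t ∈ Metric.ball o δ, deriv φ t ≠ 0) ∧
      ∀ t ∈ Metric.ball o δ, n t = Real.cos (φ t) • a + Real.sin (φ t) • b := by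
  have ho : o ∈ Metric.ball o ε := Metric.mem_ball_self hε
  obtain ⟨haa, hae, -⟩ := h o ho
  set a := n o with ha
  set b := cross e a with hb
  have hbe : inner ℝ b e = (0 : ℝ) := inner_cross_left e a
  have hba : inner ℝ b a = (0 : ℝ) := inner_cross_right e a
  have hbb : inner ℝ b b = (1 : ℝ) := by
    rw [hb, inner_cross_self, he, haa, real_inner_comm, hae]; norm_num
  have hea := (real_inner_comm a e).trans hae
  have hab := (real_inner_comm b a).trans hba
  have heb := (real_inner_comm b e).trans hbe
  have ne_of : ∀ {w : E3}, inner ℝ w w = (1 : ℝ) → w ≠ 0 := by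
    rintro w hw rfl; simp at hw
  have hdec : ∀ t ∈ Metric.ball o ε,
      n t = (inner ℝ (n t) a : ℝ) • a + (inner ℝ (n t) b : ℝ) • b := by
    intro t ht
    rw [← sub_eq_zero]
    refine eq_zero_of_orthogonal (ne_of haa) (ne_of hbb) (ne_of he) hab hae hbe ?_ ?_ ?_ <;>
      simp only [inner_sub_left, inner_add_left, real_inner_smul_left, haa, hab, hae, hba, hbb,
        hbe, (h t ht).2.1] <;> ring
  have hsq : ∀ t ∈ Metric.ball o ε,
      (inner ℝ (n t) a : ℝ) ^ 2 + (inner ℝ (n t) b : ℝ) ^ 2 = 1 := by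
    intro t ht
    have h1 := (h t ht).1
    nth_rewrite 2 [hdec t ht] at h1
    rw [inner_add_right, real_inner_smul_right, real_inner_smul_right] at h1
    linarith
  have sC : ContDiffOn ℝ ∞ (fun t => (inner ℝ (n t) a : ℝ)) (Metric.ball o ε) :=
    hn.inner ℝ contDiffOn_const
  have sS : ContDiffOn ℝ ∞ (fun t => (inner ℝ (n t) b : ℝ)) (Metric.ball o ε) :=
    hn.inner ℝ contDiffOn_const
  -- With `a = n o` as zero direction the cosine is positive near `o`, so the sine stays strictly
  -- between `-1` and `1`: there `arcsin` is smooth and also recovers the cosine.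
  have hpos : ∀ᶠ t in nhds o, 0 < (inner ℝ (n t) a : ℝ) := by
    have hc : ContinuousAt (fun t => (inner ℝ (n t) a : ℝ)) o :=
      sC.continuousOn.continuousAt (Metric.isOpen_ball.mem_nhds ho)
    refine hc.eventually (lt_mem_nhds ?_)
    change 0 < (inner ℝ a a : ℝ)
    rw [haa]; exact one_pos
  obtain ⟨δ', hδ', hball⟩ := Metric.eventually_nhds_iff_ball.1 hpos
  have hsub : Metric.ball o (min δ' ε) ⊆ Metric.ball o ε :=
    Metric.ball_subset_ball (min_le_right _ _)
  have hC : ∀ t ∈ Metric.ball o (min δ' ε), 0 < (inner ℝ (n t) a : ℝ) := fun t ht =>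
    hball t (Metric.ball_subset_ball (min_le_left _ _) ht)
  set φ : ℝ → ℝ := fun t => Real.arcsin (inner ℝ (n t) b) with hφ
  have sφ : ContDiffOn ℝ ∞ φ (Metric.ball o (min δ' ε)) := by
    intro t ht
    have h1 := hsq t (hsub ht)
    have h2 := hC t ht
    exact (Real.contDiffAt_arcsin (by intro h3; rw [h3] at h1; nlinarith)
      (by intro h3; rw [h3] at h1; nlinarith)).comp_contDiffWithinAt t ((sS.mono hsub) t ht)
  have hrep : ∀ t ∈ Metric.ball o (min δ' ε),
      n t = Real.cos (φ t) • a + Real.sin (φ t) • b := by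
    intro t ht
    have h1 := hsq t (hsub ht)
    have h2 := hC t ht
    rw [hφ, Real.cos_arcsin, Real.sin_arcsin (by nlinarith) (by nlinarith),
      show 1 - (inner ℝ (n t) b : ℝ) ^ 2 = (inner ℝ (n t) a : ℝ) ^ 2 by linarith,
      Real.sqrt_sq h2.le]
    exact hdec t (hsub ht)
  refine ⟨min δ' ε, a, b, φ, lt_min hδ' hε, min_le_right _ _, ?_, sφ, fun t ht h0 => ?_, hrep⟩
  · rw [orthonormal_iff_ite]
    intro i j
    fin_cases i <;> fin_cases j <;> simpa [-inner_self_eq_norm_sq_to_K]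
  · have hd : HasDerivAt φ 0 t := by
      rw [← h0]
      exact ((sφ.contDiffAt (Metric.isOpen_ball.mem_nhds ht)).differentiableAt
        (by simp)).hasDerivAt
    have h1 := (hd.cos.smul_const a).fun_add (hd.sin.smul_const b)
    have h2 : n =ᶠ[nhds t] fun t => Real.cos (φ t) • a + Real.sin (φ t) • b :=
      Filter.eventually_of_mem (Metric.isOpen_ball.mem_nhds ht) hrep
    apply (h t (hsub ht)).2.2
    rw [(h1.congr_of_eventuallyEq h2).deriv]
    simp

/-- Injectivity is Rolle's theorem in the second variable; the Jacobian matrix is diagonal with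
entries `1` and `φ'`. -/
theorem isParameterChange_prodMap {φ : ℝ → ℝ} {o : ℝ × ℝ} {δ : ℝ}
    (hφ : ContDiffOn ℝ ∞ φ (Metric.ball o.2 δ)) (hne : ∀ t ∈ Metric.ball o.2 δ, deriv φ t ≠ 0) :
    IsParameterChange (fun q => (q.1, φ q.2)) (Metric.ball o δ) := by
  have hmem : ∀ q ∈ Metric.ball o δ, q.2 ∈ Metric.ball o.2 δ := by
    intro q hq
    rw [← ball_prod_same] at hq
    exact hq.2
  refine ⟨contDiffOn_fst.prodMk (hφ.comp contDiffOn_snd hmem), ?_, ?_⟩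
  · have key : ∀ s ∈ Metric.ball o.2 δ, ∀ t ∈ Metric.ball o.2 δ, s < t → φ s ≠ φ t := by
      intro s hs t ht hst heq
      have hsub : Set.Icc s t ⊆ Metric.ball o.2 δ :=
        ((convex_ball o.2 δ).ordConnected).out hs ht
      obtain ⟨c, hc, h0⟩ := exists_deriv_eq_zero hst (hφ.continuousOn.mono hsub) heq
      exact hne c (hsub (Set.Ioo_subset_Icc_self hc)) h0
    intro q hq q' hq' heq
    obtain ⟨h1, h2⟩ := Prod.ext_iff.1 heq
    refine Prod.ext h1 ?_
    rcases lt_trichotomy q.2 q'.2 with hlt | he | hlt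
    · exact absurd h2 (key _ (hmem q hq) _ (hmem q' hq') hlt)
    · exact he
    · exact absurd h2.symm (key _ (hmem q' hq') _ (hmem q hq) hlt)
  · intro q hq
    have hd := ((hφ.contDiffAt (Metric.isOpen_ball.mem_nhds (hmem q hq))).differentiableAt
        (by simp)).hasDerivAt
    have hsnd : HasFDerivAt (Prod.snd : ℝ × ℝ → ℝ) (ContinuousLinearMap.snd ℝ ℝ ℝ) q :=
      hasFDerivAt_snd
    have hf : HasFDerivAt (fun q : ℝ × ℝ => (q.1, φ q.2)) _ q :=
      hasFDerivAt_fst.prodMk (hd.comp_hasFDerivAt q hsnd)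
    have hinj : Function.Injective (fderiv ℝ (fun q : ℝ × ℝ => (q.1, φ q.2)) q) := by
      rw [injective_iff_map_eq_zero, hf.fderiv]
      intro w hw
      have := hne _ (hmem q hq)
      simp [this] at hw
      exact Prod.ext hw.1 hw.2
    exact ⟨hinj, LinearMap.injective_iff_surjective.1 hinj⟩

/-! ### Assembly of the rotational parametrization. -/

/-- A Weingarten surface one of whose families of principal lines consists of geodesics, while
the curvature of the other family does not vanish, is locally a rotational surface. -/
theorem IsPrincipalSurface.isLocallyRotational {x : ℝ × ℝ → E3} {D : Set (ℝ × ℝ)}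
    (hS : IsPrincipalSurface x D)
    (hW : IsWeingarten x D)
    (hγ₁ : ∀ p ∈ D, gamma1 x p = 0)
    (hκ₂ : ∀ p ∈ D, 0 < gamma2 x p ^ 2 + nu2 x p ^ 2) :
    IsLocallyRotational x D := by
  intro o ho
  obtain ⟨ε, hε, hsub⟩ := Metric.isOpen_iff.1 hS.isOpen o ho
  have hF := (hS.isGeodesicPrincipalFrame hγ₁).mono Metric.isOpen_ball hsub
  have hk : ∀ q ∈ Metric.ball o ε, 0 < curvSq (du x) (dv x) (normal x) q := fun q hq => by
    rw [hS.curvSq_eq hγ₁ (hsub hq)]; exact hκ₂ q (hsub hq)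
  have h2 : ∀ q ∈ Metric.ball o ε, dv (curv2 (dv x) (normal x)) q = 0 := by
    obtain ⟨I, w, -, -, hw⟩ := hW
    intro q hq
    -- As `ν₁` does not depend on `v`, it may be evaluated on the line `v = o.2`; then `ν₂ = w(ν₁)`
    -- is visibly a function of the first parameter alone.
    have e : ∀ q ∈ Metric.ball o ε,
        curv2 (dv x) (normal x) q = w (curv1 (du x) (normal x) (q.1, o.2)) := by
      intro q hq
      have hq' : (q.1, o.2) ∈ Metric.ball o ε := by
        rw [← ball_prod_same] at hq ⊢
        exact ⟨hq.1, Metric.mem_ball_self hε⟩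
      rw [eq_of_dv_eq_zero (hF.smooth_curv1.differentiableOn (by simp))
        (fun q hq => hF.dv_curv1 hq) hq' (b' := q.2) hq]
      exact (hw q (hsub hq)).2
    rw [dv_congr Metric.isOpen_ball e hq]
    exact dv_comp_fst fun s => w (curv1 (du x) (normal x) (s, o.2))
  have hg : ∀ q ∈ Metric.ball o ε, dv (logDeriv (du x) (dv x)) q = 0 := fun q hq =>
    hF.dv_logDeriv h2 (fun q hq => hS.no_umbilic q (hsub hq)) hq
  obtain ⟨c, e, r, z, n, he, hr, hz, hn, hr0, hn1, hx⟩ :=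
    hF.exists_circles (hS.smooth.mono hsub) hε hk h2 hg
  obtain ⟨δ, a, b, φ, hδ, hδε, hon, hφ, hφ', hnφ⟩ := exists_angle hε he hn hn1
  have s1 : Metric.ball o.1 δ ⊆ Metric.ball o.1 ε := Metric.ball_subset_ball hδε
  have s2 : Metric.ball o.2 δ ⊆ Metric.ball o.2 ε := Metric.ball_subset_ball hδε
  have hmem : ∀ q ∈ Metric.ball o δ, q.1 ∈ Metric.ball o.1 δ ∧ q.2 ∈ Metric.ball o.2 δ := by
    intro q hq
    rw [← ball_prod_same] at hq
    exact hq
  refine ⟨Metric.ball o δ, Metric.isOpen_ball, Metric.mem_ball_self hδ,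
    (Metric.ball_subset_ball hδε).trans hsub,
    fun q => c + (r q.1 • (Real.cos q.2 • a + Real.sin q.2 • b) + z q.1 • e),
    Metric.ball o.1 δ, fun q => (q.1, φ q.2),
    ⟨c, ![a, b, e], r, z, hon, Metric.isOpen_ball, (convex_ball _ _).ordConnected, hr.mono s1,
      hz.mono s1, fun t ht => hr0 t (s1 ht), fun t ht => ?_, fun t _ φ => by simp⟩,
    isParameterChange_prodMap hφ hφ', fun q hq => (hmem q hq).1, fun q hq => ?_⟩
  -- If `r'` and `z'` vanished together at `t`, then `x_u` would vanish at `(t, o.2)`, contradicting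
  -- regularity.
  · by_contra! hcon
    have hdr := ((hr.contDiffAt (Metric.isOpen_ball.mem_nhds (s1 ht))).differentiableAt
      (by simp)).hasDerivAt
    have hdz := ((hz.contDiffAt (Metric.isOpen_ball.mem_nhds (s1 ht))).differentiableAt
      (by simp)).hasDerivAt
    rw [hcon.1] at hdr
    rw [hcon.2] at hdz
    have ho2 : o.2 ∈ Metric.ball o.2 ε := Metric.mem_ball_self hε
    have hm : (t, o.2) ∈ Metric.ball o ε := by
      rw [← ball_prod_same]; exact ⟨s1 ht, ho2⟩
    have hd := ((hdr.smul_const (n o.2)).fun_add (hdz.smul_const e)).const_add c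
    have heq : (fun s => x (s, o.2)) =ᶠ[nhds t] fun s => c + (r s • n o.2 + z s • e) :=
      Filter.eventually_of_mem (Metric.isOpen_ball.mem_nhds (s1 ht)) fun s hs => hx s hs _ ho2
    have hdu := hasDerivAt_du (differentiableAt_of_contDiffOn hS.isOpen hS.smooth (hsub hm))
    apply hS.du_ne (hsub hm)
    rw [hdu.unique (hd.congr_of_eventuallyEq heq)]
    simp
  · obtain ⟨h1, h2⟩ := hmem q hq
    rw [show x q = x (q.1, q.2) from rfl, hx _ (s1 h1) _ (s2 h2), hnφ _ h2]

end WeingartenSurface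

end

theorem theorem4p2 (x : ℝ × ℝ → WeingartenSurface.E3) (D : Set (ℝ × ℝ))
    (hS : WeingartenSurface.IsPrincipalSurface x D)
    (hW : WeingartenSurface.IsWeingarten x D)
    (hγ₁ : ∀ p ∈ D, WeingartenSurface.gamma1 x p = 0)
    (hκ₂ : ∀ p ∈ D, 0 < WeingartenSurface.gamma2 x p ^ 2 + WeingartenSurface.nu2 x p ^ 2) :
    WeingartenSurface.IsLocallyRotational x D :=
  hS.isLocallyRotational hW hγ₁ hκ₂
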